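/- Let $G$ be a finite undirected connected loopless multigraph on the vertices $0,\dots,n$. Let $H_0=\{x\in\mathbb R^{n+1}: \sum_i x_i=0\}$ with its Euclidean topology, and let $L_G\subset H_0$ be the Laplacian lattice of $G$, i.e. the group generated by the rows of the Laplacian matrix of $G$. For $P\subseteq H_0$, $p\in H_0$ and $r\in\mathbb R$ put $P(p,r)=p+rP$. Let $\triangle\subset H_0$ be the convex hull of the points $t_0,\dots,t_n$, where $t_i$ has $i$-th coordinate $n$ and all other coordinates $-1$. Let $d_\triangle(p,q)=\inf\{\lambda\ge 0: q\in\triangle(p,\lambda)\}$ and $h(p)=\min_{q\in L_G}d_\triangle(p,q)$ for $p,q\in H_0$, and let $\mathrm{Crit}_\triangle(L_G)$ be the set of local maxima of $h$ on $H_0$. The critical automorphism group of $G$ is the group of non-singular linear maps $H_0\to H_0$ that induce a bijection of $\mathrm{Crit}_\triangle(L_G)$ onto itself. Say that $G$ has duality with respect to a polytope $P\subset H_0$, with dual body $P^*$, if $P^*\subset H_0$ is a star-shaped body (compact, star-shaped with respect to the origin, with the origin in its interior) such that for every $R>0$ for which $\bigcup_{c\in \mathrm{Crit}_\triangle(L_G)}P(c,R)\neq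 H_0$ there is an $R'>0$ such that, for all $p\in H_0$, the point $p$ lies in the interior of $\bigcup_{c\in \mathrm{Crit}_\triangle(L_G)}P(c,R)$ if and only if $p\notin\bigcup_{q\in L_G}P^*(q,R')$. Theorem. Let $S\subset H_0$ be a full-dimensional simplex with centroid at the origin. If there is an element $M$ of the critical automorphism group of $G$ with $M(\triangle)=S$, then $G$ has duality with respect to $S$, with dual body $-S$. -/

import Mathlib

open scoped Pointwise

noncomputable section

namespace GraphDuality

/-- A finite undirected multigraph without loops on the vertices `0, …, n`;
`b i j` is the number of edges between `i` and `j`. -/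
structure Multigraph (n : ℕ) where
  b : Fin (n + 1) → Fin (n + 1) → ℕ
  symm : ∀ i j, b i j = b j i
  loopless : ∀ i, b i i = 0

/-- The simple graph whose edges are the pairs joined by at least one edge. -/
def Multigraph.support {n : ℕ} (G : Multigraph n) : SimpleGraph (Fin (n + 1)) where
  Adj i j := G.b i j ≠ 0
  symm := ⟨fun i j h => by rw [G.symm j i]; exact h⟩
  loopless := ⟨fun i h => h (G.loopless i)⟩

def Multigraph.Connected {n : ℕ} (G : Multigraph n) : Prop := G.support.Connected

/-- The Laplacian matrix `D(G) - A(G)`. -/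
def Multigraph.laplacian {n : ℕ} (G : Multigraph n) :
    Matrix (Fin (n + 1)) (Fin (n + 1)) ℤ :=
  Matrix.diagonal (fun i => ∑ j, (G.b i j : ℤ)) - Matrix.of (fun i j => (G.b i j : ℤ))

/-- The hyperplane `H₀` of vectors with coordinate sum zero, with the Euclidean structure. -/
def H0 (n : ℕ) : Submodule ℝ (EuclideanSpace ℝ (Fin (n + 1))) where
  carrier := {x | ∑ i, x i = 0}
  add_mem' {x y} hx hy := by
    have h1 : ∑ i, x i = 0 := hx
    have h2 : ∑ i, y i = 0 := hy
    change ∑ i, (x + y) i = 0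
    simp [Finset.sum_add_distrib, h1, h2]
  zero_mem' := by simp
  smul_mem' c x hx := by
    have h1 : ∑ i, x i = 0 := hx
    change ∑ i, (c • x) i = 0
    simp [← Finset.mul_sum, h1]

/-- The `i`-th row of the Laplacian matrix, as a vector of `H₀`. -/
def Multigraph.row {n : ℕ} (G : Multigraph n) (i : Fin (n + 1)) : H0 n :=
  ⟨WithLp.toLp 2 (fun j => (G.laplacian i j : ℝ)), by
    change ∑ j, (G.laplacian i j : ℝ) = 0
    simp [Multigraph.laplacian, Matrix.diagonal_apply]⟩

/-- The Laplacian lattice `L_G`. -/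
def Multigraph.lattice {n : ℕ} (G : Multigraph n) : AddSubgroup (H0 n) :=
  AddSubgroup.closure (Set.range G.row)

/-- The vertex `t_i` of the standard regular simplex: coordinate `n` at `i`, and `-1` elsewhere. -/
def simplexVertex (n : ℕ) (i : Fin (n + 1)) : H0 n :=
  ⟨WithLp.toLp 2 (fun j => if i = j then (n : ℝ) else -1), by
    change ∑ j, (if i = j then (n : ℝ) else -1) = 0
    rw [← Finset.add_sum_erase _ _ (Finset.mem_univ i), Finset.sum_congr rfl
      (g := fun _ => (-1 : ℝ)) (fun j hj => if_neg (Finset.ne_of_mem_erase hj).symm)]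
    simp⟩

/-- The standard regular simplex `△` in `H₀`. -/
def regularSimplex (n : ℕ) : Set (H0 n) := convexHull ℝ (Set.range (simplexVertex n))

section General

variable {E : Type*} [NormedAddCommGroup E] [NormedSpace ℝ E]

/-- `P(p, r) = p + r P`. -/
def dilate (P : Set E) (p : E) (r : ℝ) : Set E := (fun x => p + r • x) '' P

/-- The polyhedral distance function `d_P(p, q)`. -/
def polyDist (P : Set E) (p q : E) : ℝ := sInf {r : ℝ | 0 ≤ r ∧ q ∈ dilate P p r}

/-- The distance function `h_{P,D}(p) = min_{q ∈ D} d_P(p, q)` of a point set `D`.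
(For a nonempty closed discrete set `D` and a polytope `P` with the origin in its interior
the infimum is attained.) -/
def distFun (P D : Set E) (p : E) : ℝ := sInf (polyDist P p '' D)

/-- `Crit_P(D)`, the set of local maxima of `h_{P,D}`. -/
def crit (P D : Set E) : Set E := {c | IsLocalMax (distFun P D) c}

/-- The arrangement `⋃_{q ∈ D} P(q, r)`. -/
def arrangement (D P : Set E) (r : ℝ) : Set E := ⋃ q ∈ D, dilate P q r

/-- A star-shaped body with centre the origin. -/
structure IsStarBody (K : Set E) : Prop where
  isCompact : IsCompact K
  zero_mem_interior : (0 : E) ∈ interior K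
  starConvex : StarConvex ℝ 0 K

end General

/-- `Crit_△(L_G)`. -/
def Multigraph.critSet {n : ℕ} (G : Multigraph n) : Set (H0 n) :=
  crit (regularSimplex n) (G.lattice : Set (H0 n))

/-- The critical automorphism group of `G`: the non-singular linear maps of `H₀` that induce a
bijection of `Crit_△(L_G)` onto itself. (`H₀` is the span of `L_G` for connected `G`.) -/
def Multigraph.criticalAutomorphismGroup {n : ℕ} (G : Multigraph n) :
    Subgroup (H0 n ≃ₗ[ℝ] H0 n) where
  carrier := {M | Set.BijOn M G.critSet G.critSet}
  mul_mem' {_ _} hM hN := hM.comp hN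
  one_mem' := Set.bijOn_id _
  inv_mem' {M} hM := by
    have h : Set.InvOn (M⁻¹ : H0 n ≃ₗ[ℝ] H0 n) M G.critSet G.critSet :=
      ⟨fun x _ => M.symm_apply_apply x, fun x _ => M.apply_symm_apply x⟩
    exact (Set.bijOn_comm h).2 hM

/-- `K` is a dual body of `P` for the graph `G`: a star-shaped body such that for every radius
`R > 0` at which the arrangement of the `P(c, R)`, `c ∈ Crit_△(L_G)`, does not cover `H₀`, there is
`R' > 0` such that the interior of this arrangement is exactly the complement of the arrangement of
the `K(q, R')`, `q ∈ L_G`. (When the first arrangement covers `H₀`, no nonempty `K` can have this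
property.) -/
def Multigraph.IsDualBody {n : ℕ} (G : Multigraph n) (P K : Set (H0 n)) : Prop :=
  IsStarBody K ∧
    ∀ R : ℝ, 0 < R → arrangement G.critSet P R ≠ Set.univ →
      ∃ R' : ℝ, 0 < R' ∧ ∀ p : H0 n,
        p ∈ interior (arrangement G.critSet P R) ↔
          p ∉ arrangement (G.lattice : Set (H0 n)) K R'

/-- `G` has duality with respect to `P`. -/
def Multigraph.HasDuality {n : ℕ} (G : Multigraph n) (P : Set (H0 n)) : Prop :=
  ∃ K : Set (H0 n), G.IsDualBody P K

end GraphDuality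

end

/-! Write `h` for the △-distance to the lattice. In coordinates, `h p ≤ t` says that some lattice
point `q` has `p i - q i ≤ t` for all `i`. Hence the sets -△(q, R') around the lattice fill exactly
the sublevel set {h ≤ R'}.

The crux is that the sets △(c, R) around the critical points fill exactly the superlevel set {h ≥ m
- R}, with m = |E|/(n+1) the maximum of `h`. One inclusion is the Lipschitz property
`height_le_add`. The other, `exists_height_eq_maxHeight`, is chip-firing: reduced divisors and
Dhar's burning algorithm place below every integer point not strictly dominated by the lattice an
extremal one of coordinate sum -|E| (`exists_extremal_le`). Since `h` has no positive local minimum,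
the interior of {h ≥ s} is {h > s} for s > 0, which proves duality for △ with R' = m - R.

For S = M(△), the lattice is recovered as the group of translations preserving the critical set
(`mem_lattice_iff_critSet`). So `M` preserves it too, and the duality is carried over by `M`. -/

namespace GraphDuality

/-! ### Chip-firing: reduced divisors, acyclic orientations, burning. -/

namespace Multigraph

variable {n : ℕ} (G : Multigraph n)

/-- The Laplacian applied to an integer function on the vertices. -/
def lap (f : Fin (n + 1) → ℤ) (v : Fin (n + 1)) : ℤ := ∑ w, (G.b v w : ℤ) * (f v - f w)

theorem lap_add (f g : Fin (n + 1) → ℤ) (v : Fin (n + 1)) :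
    G.lap (f + g) v = G.lap f v + G.lap g v := by
  simp only [lap, ← Finset.sum_add_distrib, Pi.add_apply]
  exact Finset.sum_congr rfl fun w _ => by ring

theorem lap_smul (k : ℤ) (f : Fin (n + 1) → ℤ) (v : Fin (n + 1)) :
    G.lap (fun w => k * f w) v = k * G.lap f v := by
  simp only [lap, Finset.mul_sum]
  exact Finset.sum_congr rfl fun w _ => by ring

theorem lap_neg (f : Fin (n + 1) → ℤ) (v : Fin (n + 1)) : G.lap (-f) v = -G.lap f v := by
  have h := G.lap_smul (-1) f v
  have e : (fun w => -1 * f w) = -f := by ext w; simp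
  rw [e] at h
  rw [h]; ring

theorem sum_lap (f : Fin (n + 1) → ℤ) : ∑ v, G.lap f v = 0 := by
  have h : ∑ v, G.lap f v = -∑ v, G.lap f v := by
    conv_lhs => simp only [lap]
    rw [Finset.sum_comm, ← Finset.sum_neg_distrib]
    refine Finset.sum_congr rfl fun v _ => ?_
    rw [lap, ← Finset.sum_neg_distrib]
    exact Finset.sum_congr rfl fun w _ => by rw [G.symm w v]; ring
  linarith

/-- The Laplacian of an integer function is nonnegative where the function is maximal. -/
theorem lap_nonneg_of_max {f : Fin (n + 1) → ℤ} {v : Fin (n + 1)} (h : ∀ w, f w ≤ f v) :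
    0 ≤ G.lap f v :=
  Finset.sum_nonneg fun w _ => mul_nonneg (by positivity) (sub_nonneg.2 (h w))

/-- On a connected graph there is a function that is strictly superharmonic off a vertex. -/
theorem exists_lap_pos (hG : G.Connected) (v₀ : Fin (n + 1)) :
    ∃ g : Fin (n + 1) → ℤ, ∀ v, v ≠ v₀ → 1 ≤ G.lap g v := by
  set d : Fin (n + 1) → ℕ := fun v => G.support.dist v₀ v with hd
  obtain ⟨N, hN⟩ : ∃ N, ∀ v, d v + 1 ≤ N :=
    ⟨(∑ v, d v) + 1, fun v => Nat.succ_le_succ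
      (Finset.single_le_sum (f := d) (fun _ _ => Nat.zero_le _) (Finset.mem_univ v))⟩
  set K : ℤ := 1 + ∑ v, ∑ w, (G.b v w : ℤ) with hK
  have hK1 : 1 ≤ K := by
    have : (0 : ℤ) ≤ ∑ v, ∑ w, (G.b v w : ℤ) := by positivity
    linarith
  have hdeg : ∀ v, 1 + ∑ w, (G.b v w : ℤ) ≤ K := fun v => by
    have := Finset.single_le_sum (f := fun v => ∑ w, (G.b v w : ℤ))
      (fun _ _ => by positivity) (Finset.mem_univ v)
    linarith
  have hpow : ∀ k, 1 ≤ K ^ k := fun k => one_le_pow₀ hK1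
  -- A function of the distance to `v₀` whose increments shrink by the factor `K`, which exceeds
  -- every degree: the gain along one edge towards `v₀` outweighs the losses along all other edges.
  -- `N` keeps the exponents from truncating.
  refine ⟨fun v => ∑ k ∈ Finset.range (d v), K ^ (N - (k + 1)), fun v hv => ?_⟩
  set φ : ℕ → ℤ := fun e => ∑ k ∈ Finset.range e, K ^ (N - (k + 1)) with hφ
  have hmono : Monotone φ := monotone_nat_of_le_succ fun e => by
    simp only [hφ, Finset.sum_range_succ]
    linarith [hpow (N - (e + 1))]
  obtain ⟨u, hu, hdu⟩ : ∃ u, G.support.Adj v u ∧ d v = d u + 1 := by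
    obtain ⟨p, hp⟩ := (hG.preconnected v v₀).exists_walk_length_eq_dist
    cases p with
    | nil => exact absurd rfl hv
    | cons h q =>
      rename_i u
      refine ⟨u, h, ?_⟩
      have h1 : G.support.dist u v₀ ≤ q.length := SimpleGraph.dist_le q
      have h2 : G.support.dist v v₀ ≤ G.support.dist u v₀ + 1 := by
        obtain ⟨q', hq'⟩ := (hG.preconnected u v₀).exists_walk_length_eq_dist
        have := SimpleGraph.dist_le (SimpleGraph.Walk.cons h q')
        simp only [SimpleGraph.Walk.length_cons] at this
        omega
      simp only [SimpleGraph.Walk.length_cons] at hp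
      simp only [hd, SimpleGraph.dist_comm (u := v₀)]
      omega
  have hstep : ∀ w, (G.b v w : ℤ) * -K ^ (N - (d v + 1)) ≤ (G.b v w : ℤ) * (φ (d v) - φ (d w)) := by
    intro w
    by_cases hb : G.b v w = 0
    · simp [hb]
    · refine mul_le_mul_of_nonneg_left ?_ (by positivity)
      have hw : d w ≤ d v + 1 := by
        obtain ⟨q', hq'⟩ := (hG.preconnected v v₀).exists_walk_length_eq_dist
        have hadj : G.support.Adj w v := SimpleGraph.Adj.symm (show G.support.Adj v w from hb)
        have := SimpleGraph.dist_le (SimpleGraph.Walk.cons hadj q')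
        simp only [SimpleGraph.Walk.length_cons] at this
        simp only [hd, SimpleGraph.dist_comm (u := v₀)]
        omega
      have h1 := hmono hw
      have h2 : φ (d v + 1) = φ (d v) + K ^ (N - (d v + 1)) := Finset.sum_range_succ _ _
      linarith
  have hu' : (G.b v u : ℤ) * -K ^ (N - (d v + 1)) + K ^ (N - d v) ≤
      (G.b v u : ℤ) * (φ (d v) - φ (d u)) := by
    have h2 : φ (d v) = φ (d u) + K ^ (N - d v) := by
      rw [hdu]; exact Finset.sum_range_succ _ _
    have hb : (1 : ℤ) ≤ G.b v u := by
      exact_mod_cast Nat.one_le_iff_ne_zero.2 (show G.b v u ≠ 0 from hu)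
    have h3 := hpow (N - (d v + 1))
    have h4 := hpow (N - d v)
    have h5 : φ (d v) - φ (d u) = K ^ (N - d v) := by linarith
    rw [h5]
    nlinarith [mul_nonneg (sub_nonneg.2 hb) (zero_le_one.trans h4),
      mul_nonneg (zero_le_one.trans hb) (zero_le_one.trans h3)]
  have hsum : (∑ w, (G.b v w : ℤ)) * -K ^ (N - (d v + 1)) + K ^ (N - d v) ≤
      ∑ w, (G.b v w : ℤ) * (φ (d v) - φ (d w)) := by
    rw [Finset.sum_mul, ← Finset.add_sum_erase _ _ (Finset.mem_univ u),
      ← Finset.add_sum_erase _ (fun w => (G.b v w : ℤ) * (φ (d v) - φ (d w))) (Finset.mem_univ u)]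
    have := Finset.sum_le_sum (s := Finset.univ.erase u) fun w _ => hstep w
    linarith
  have hNk : K ^ (N - d v) = K ^ (N - (d v + 1)) * K := by
    rw [← pow_succ]; congr 1; have := hN v; omega
  change 1 ≤ ∑ w, (G.b v w : ℤ) * (φ (d v) - φ (d w))
  nlinarith [hpow (N - (d v + 1)), hdeg v]

/-- Existence of a reduced representative: a function `f` such that `D - lap f` is nonnegative off
`v₀` and no set of vertices avoiding `v₀` can be fired. -/
theorem exists_reduced (hG : G.Connected) (v₀ : Fin (n + 1)) (D : Fin (n + 1) → ℤ) :
    ∃ f : Fin (n + 1) → ℤ, (∀ v, v ≠ v₀ → G.lap f v ≤ D v) ∧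
      ∀ B : Finset (Fin (n + 1)), v₀ ∈ B → B ≠ Finset.univ →
        ∃ v ∉ B, D v - G.lap f v < ∑ w ∈ B, (G.b v w : ℤ) := by
  classical
  obtain ⟨g, hg⟩ := G.exists_lap_pos hG v₀
  set K : ℤ := 1 + ∑ v, |D v| with hK
  have hDK : ∀ v, |D v| + 1 ≤ K := fun v => by
    have := Finset.single_le_sum (f := fun v => |D v|) (fun _ _ => abs_nonneg _) (Finset.mem_univ v)
    linarith
  -- Maximum principle for `f - K g`: its Laplacian is negative off `v₀`, so its maximum is at `v₀`.
  have hbound : ∀ f : Fin (n + 1) → ℤ, f v₀ = 0 → (∀ v, v ≠ v₀ → G.lap f v ≤ D v) →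
      ∀ v, f v ≤ K * (g v - g v₀) := by
    intro f hf0 hf v
    obtain ⟨u, -, hu⟩ := Finset.exists_max_image Finset.univ (fun w => f w + -K * g w)
      Finset.univ_nonempty
    have hlap := G.lap_nonneg_of_max (f := f + fun w => -K * g w) (v := u)
      (fun w => hu w (Finset.mem_univ w))
    rw [lap_add, lap_smul] at hlap
    have huv : u = v₀ := by
      by_contra hne
      have h1 := hf u hne
      have h2 := hg u hne
      have h3 := hDK u
      have h4 := le_abs_self (D u)
      have h5 := abs_nonneg (D u)
      nlinarith
    have := hu v (Finset.mem_univ v)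
    simp only [huv, hf0] at this
    linarith
  have hex : ∃ z : ℤ, ∃ f : Fin (n + 1) → ℤ, (f v₀ = 0 ∧ ∀ v, v ≠ v₀ → G.lap f v ≤ D v) ∧
      ∑ v, f v = z := by
    refine ⟨_, fun v => -K * (g v + -g v₀), ⟨by ring, fun v hv => ?_⟩, rfl⟩
    rw [lap_smul, show (fun v => g v + -g v₀) = g + fun _ => -g v₀ from rfl, lap_add]
    have h0 : G.lap (fun _ => -g v₀) v = 0 := by simp [lap]
    have h2 := hg v hv
    have h3 := hDK v
    have h4 := neg_abs_le (D v)
    have h5 := abs_nonneg (D v)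
    rw [h0]
    nlinarith
  -- Take an admissible `f` of largest total; a legal firing of the complement of some `B` would
  -- increase it.
  obtain ⟨z, ⟨f, ⟨hf0, hf⟩, rfl⟩, hmax⟩ := Int.exists_greatest_of_bdd
    (P := fun z => ∃ f : Fin (n + 1) → ℤ, (f v₀ = 0 ∧ ∀ v, v ≠ v₀ → G.lap f v ≤ D v) ∧
      ∑ v, f v = z)
    ⟨∑ v, K * (g v - g v₀), by
      rintro z ⟨f, ⟨hf0, hf⟩, rfl⟩
      exact Finset.sum_le_sum fun v _ => hbound f hf0 hf v⟩ hex
  refine ⟨f, hf, fun B hv₀ hB => ?_⟩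
  by_contra hcon
  push Not at hcon
  set e : Fin (n + 1) → ℤ := fun v => if v ∈ B then 0 else 1 with he
  have hle := hmax _ ⟨f + e, ⟨by simp [he, hv₀, hf0], fun v hv => ?_⟩, rfl⟩
  · obtain ⟨u, hu⟩ : ∃ u, u ∉ B := by
      by_contra h
      push Not at h
      exact hB (Finset.eq_univ_iff_forall.2 h)
    have h1 : e u ≤ ∑ v, e v := Finset.single_le_sum (f := e)
      (fun v _ => by simp only [he]; split_ifs <;> norm_num) (Finset.mem_univ u)
    simp only [Pi.add_apply, Finset.sum_add_distrib] at hle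
    have h2 : e u = 1 := by simp [he, hu]
    linarith
  · rw [lap_add]
    by_cases hvB : v ∈ B
    · have h1 : G.lap e v ≤ 0 := by
        refine Finset.sum_nonpos fun w _ => mul_nonpos_of_nonneg_of_nonpos (by positivity) ?_
        simp only [he, hvB, if_true]
        split_ifs <;> norm_num
      linarith [hf v hv]
    · have h1 : G.lap e v = ∑ w ∈ B, (G.b v w : ℤ) := by
        rw [lap, ← Finset.sum_filter_add_sum_filter_not _ (· ∈ B)]
        rw [Finset.sum_congr rfl (g := fun w => (G.b v w : ℤ)),
          Finset.sum_eq_zero (s := Finset.filter (fun w => ¬ w ∈ B) _)]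
        · simp
        · intro w hw
          simp [he, hvB, (Finset.mem_filter.1 hw).2]
        · intro w hw
          simp [he, hvB, (Finset.mem_filter.1 hw).2]
      linarith [hcon v hvB]

/-- The number of edges from `v` to vertices of smaller rank. -/
def indeg (r : Fin (n + 1) → ℕ) (v : Fin (n + 1)) : ℤ :=
  ∑ w, if r w < r v then (G.b v w : ℤ) else 0

/-- Each edge is counted once, at its end of larger rank. -/
theorem two_mul_sum_indeg {r : Fin (n + 1) → ℕ} (hr : Function.Injective r) :
    2 * ∑ v, G.indeg r v = ∑ v, ∑ w, (G.b v w : ℤ) := by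
  have h : ∑ v, G.indeg r v = ∑ v, ∑ w, if r v < r w then (G.b v w : ℤ) else 0 := by
    simp only [indeg]
    rw [Finset.sum_comm]
    simp only [G.symm]
  rw [two_mul]
  nth_rewrite 2 [h]
  simp only [indeg, ← Finset.sum_add_distrib]
  refine Finset.sum_congr rfl fun v _ => Finset.sum_congr rfl fun w _ => ?_
  rcases lt_trichotomy (r w) (r v) with h | h | h
  · simp [h, h.not_gt]
  · simp [hr h, G.loopless]
  · simp [h, h.not_gt]

/-- The chip configuration of an acyclic orientation is not equivalent to an effective one. -/
theorem exists_lap_le_neg_indeg {r : Fin (n + 1) → ℕ} (f : Fin (n + 1) → ℤ) :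
    ∃ v, G.lap f v ≤ -G.indeg r v := by
  obtain ⟨u, -, hu⟩ := Finset.exists_min_image Finset.univ f Finset.univ_nonempty
  -- Among the minimizers of `f` take the one of least rank: every vertex of smaller rank then has a
  -- strictly larger value.
  obtain ⟨v, hv, hvmin⟩ := Finset.exists_min_image (Finset.univ.filter fun w => f w = f u) r
    ⟨u, by simp⟩
  have hfv : f v = f u := (Finset.mem_filter.1 hv).2
  refine ⟨v, ?_⟩
  rw [lap, indeg, ← Finset.sum_neg_distrib]
  refine Finset.sum_le_sum fun w _ => ?_
  have h1 := hu w (Finset.mem_univ w)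
  split_ifs with h
  · have h2 : f w ≠ f u := fun h2 => by
      have := hvmin w (by simp [h2])
      omega
    have h3 : f v - f w ≤ -1 := by omega
    have h4 : (0 : ℤ) ≤ G.b v w := by positivity
    nlinarith
  · have h3 : f v - f w ≤ 0 := by omega
    have h4 : (0 : ℤ) ≤ G.b v w := by positivity
    nlinarith

/-- Dhar's burning algorithm, producing a linear order of the vertices. -/
theorem exists_rank (D : Fin (n + 1) → ℤ) (v₀ : Fin (n + 1)) (h₀ : D v₀ < 0)
    (h : ∀ B : Finset (Fin (n + 1)), v₀ ∈ B → B ≠ Finset.univ →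
        ∃ v ∉ B, D v < ∑ w ∈ B, (G.b v w : ℤ)) :
    ∃ r : Fin (n + 1) → ℕ, Function.Injective r ∧ ∀ v, D v < G.indeg r v := by
  classical
  -- `B` is the burnt set after `k` steps and `r` the time of burning.
  have key : ∀ k ≤ n, ∃ (B : Finset (Fin (n + 1))) (r : Fin (n + 1) → ℕ), B.card = k + 1 ∧ v₀ ∈ B ∧
      Set.InjOn r B ∧ (∀ v ∈ B, r v < k + 1) ∧
      ∀ v ∈ B, D v < ∑ w ∈ B, if r w < r v then (G.b v w : ℤ) else 0 := by
    intro k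
    induction k with
    | zero =>
      intro _
      exact ⟨{v₀}, fun _ => 0, by simp, by simp, by simp, by simp, by simpa using h₀⟩
    | succ k ih =>
      intro hk
      obtain ⟨B, r, hcard, hv₀, hinj, hlt, hD⟩ := ih (by omega)
      obtain ⟨v, hv, hDv⟩ := h B hv₀ (fun hB => by
        rw [hB, Finset.card_univ, Fintype.card_fin] at hcard
        omega)
      have hne : ∀ w ∈ B, w ≠ v := fun w hw hwv => hv (hwv ▸ hw)
      have hupd : ∀ w ∈ B, Function.update r v (k + 1) w = r w := fun w hw =>
        Function.update_of_ne (hne w hw) _ _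
      refine ⟨insert v B, Function.update r v (k + 1), ?_, Finset.mem_insert_of_mem hv₀, ?_, ?_, ?_⟩
      · rw [Finset.card_insert_of_notMem hv, hcard]
      · rw [Finset.coe_insert, Set.injOn_insert (by simpa using hv)]
        refine ⟨fun x hx y hy hxy => ?_, ?_⟩
        · rw [hupd x hx, hupd y hy] at hxy
          exact hinj hx hy hxy
        · rintro ⟨w, hw, hwv⟩
          rw [hupd w hw, Function.update_self] at hwv
          have := hlt w hw
          omega
      · intro w hw
        rcases Finset.mem_insert.1 hw with rfl | hw
        · simp
        · rw [hupd w hw]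
          have := hlt w hw
          omega
      · intro w hw
        rw [Finset.sum_insert hv]
        rcases Finset.mem_insert.1 hw with rfl | hw
        · rw [Finset.sum_congr rfl (g := fun u => (G.b w u : ℤ))]
          · simpa using hDv
          · intro u hu
            rw [hupd u hu, Function.update_self, if_pos (hlt u hu)]
        · rw [Finset.sum_congr rfl (g := fun u => if r u < r w then (G.b w u : ℤ) else 0)]
          · have h1 := hD w hw
            have h2 : (0 : ℤ) ≤ if Function.update r v (k + 1) v < Function.update r v (k + 1) w
                then (G.b w v : ℤ) else 0 := by split_ifs <;> positivity
            linarith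
          · intro u hu
            rw [hupd u hu, hupd w hw]
  obtain ⟨B, r, hcard, -, hinj, -, hD⟩ := key n le_rfl
  have hB : B = Finset.univ := Finset.eq_univ_of_card B (by simpa using hcard)
  subst hB
  exact ⟨r, fun x y hxy => hinj (by simp) (by simp) hxy, fun v => hD v (Finset.mem_univ v)⟩

/-- Every integer point not strictly below any lattice point lies above such a point whose
coordinate sum is minus the number of edges. -/
theorem exists_extremal_le (hG : G.Connected) (x : Fin (n + 1) → ℤ)
    (hx : ∀ f, ∃ i, G.lap f i ≤ x i) :
    ∃ y : Fin (n + 1) → ℤ, (∀ i, y i ≤ x i) ∧ (∀ f, ∃ i, G.lap f i ≤ y i) ∧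
      2 * ∑ i, y i = -∑ v, ∑ w, (G.b v w : ℤ) := by
  -- The hypothesis on `x` says that -x - 1 is not equivalent to an effective divisor, so its
  -- reduced form is negative at the base vertex and the fire can start there.
  obtain ⟨f, hf, hB⟩ := G.exists_reduced hG 0 (fun v => -x v - 1)
  have h₀ : -x 0 - 1 - G.lap f 0 < 0 := by
    obtain ⟨i, hi⟩ := hx (-f)
    rw [lap_neg] at hi
    by_cases h : i = 0
    · subst h; linarith
    · have := hf i h; linarith
  obtain ⟨r, hr, hD⟩ := G.exists_rank (fun v => -x v - 1 - G.lap f v) 0 h₀ hB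
  refine ⟨fun v => -G.lap f v - G.indeg r v, fun i => ?_, fun f' => ?_, ?_⟩
  · have := hD i
    simp only at this ⊢
    omega
  · obtain ⟨i, hi⟩ := G.exists_lap_le_neg_indeg (r := r) (f' + f)
    rw [lap_add] at hi
    exact ⟨i, by linarith⟩
  · rw [Finset.sum_sub_distrib, Finset.sum_neg_distrib, sum_lap, ← G.two_mul_sum_indeg hr]
    ring

end Multigraph

end GraphDuality

/-! ### Coordinates on `H0` and the simplex distance. -/

namespace GraphDuality

variable {n : ℕ}

namespace H0

theorem sum_coord (p : H0 n) : ∑ i, p.1 i = 0 := p.2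

@[simp] theorem add_coord (p q : H0 n) (i : Fin (n + 1)) : (p + q).1 i = p.1 i + q.1 i := rfl

@[simp] theorem sub_coord (p q : H0 n) (i : Fin (n + 1)) : (p - q).1 i = p.1 i - q.1 i := rfl

@[simp] theorem neg_coord (p : H0 n) (i : Fin (n + 1)) : (-p).1 i = -p.1 i := rfl

@[simp] theorem smul_coord (c : ℝ) (p : H0 n) (i : Fin (n + 1)) : (c • p).1 i = c * p.1 i := rfl

@[simp] theorem zsmul_coord (k : ℤ) (p : H0 n) (i : Fin (n + 1)) :
    (k • p).1 i = k * p.1 i := by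
  rw [← Int.cast_smul_eq_zsmul ℝ]
  rfl

@[simp] theorem zero_coord (i : Fin (n + 1)) : (0 : H0 n).1 i = 0 := rfl

theorem ext_coord {p q : H0 n} (h : ∀ i, p.1 i = q.1 i) : p = q :=
  Subtype.ext (PiLp.ext h)

theorem eq_of_le {p q : H0 n} (h : ∀ i, p.1 i ≤ q.1 i) : p = q := by
  refine ext_coord fun i => ?_
  have := (Finset.sum_eq_sum_iff_of_le (s := Finset.univ) fun i _ => h i).1
    ((sum_coord p).trans (sum_coord q).symm)
  exact this i (Finset.mem_univ i)

theorem exists_nonneg (p : H0 n) : ∃ i, 0 ≤ p.1 i := by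
  by_contra! h
  exact (sum_coord p).not_lt (Finset.sum_neg (fun i _ => h i) Finset.univ_nonempty)

theorem abs_coord_le_norm (p : H0 n) (i : Fin (n + 1)) : |p.1 i| ≤ ‖p‖ := by
  simpa using PiLp.norm_apply_le p.1 i

theorem continuous_coord (i : Fin (n + 1)) : Continuous fun p : H0 n => p.1 i := by
  fun_prop

/-- The projection of a point of `ℝⁿ⁺¹` to `H₀` along the all-ones vector. -/
noncomputable def proj (x : Fin (n + 1) → ℝ) : H0 n :=
  ⟨WithLp.toLp 2 fun i => x i - (∑ j, x j) / (n + 1), by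
    change ∑ i, (x i - (∑ j, x j) / (n + 1)) = 0
    have : (n + 1 : ℝ) ≠ 0 := by positivity
    simp [Finset.sum_sub_distrib]
    field_simp
    ring⟩

theorem proj_coord (x : Fin (n + 1) → ℝ) (i : Fin (n + 1)) :
    (proj x).1 i = x i - (∑ j, x j) / (n + 1) := rfl

end H0

theorem simplexVertex_coord (i j : Fin (n + 1)) :
    (simplexVertex n i).1 j = if i = j then (n : ℝ) else -1 := rfl

theorem coord_sum {ι : Type*} (s : Finset ι) (f : ι → H0 n) (j : Fin (n + 1)) :
    (∑ i ∈ s, f i).1 j = ∑ i ∈ s, (f i).1 j := by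
  classical
  induction s using Finset.induction_on with
  | empty => simp
  | insert a s ha ih => rw [Finset.sum_insert ha, Finset.sum_insert ha, H0.add_coord, ih]

theorem mem_regularSimplex {x : H0 n} : x ∈ regularSimplex n ↔ ∀ i, -1 ≤ x.1 i := by
  constructor
  · intro hx i
    have hc : Convex ℝ {x : H0 n | -1 ≤ x.1 i} := by
      intro a ha b hb s t hs ht hst
      have ha' : -1 ≤ a.1 i := ha
      have hb' : -1 ≤ b.1 i := hb
      change -1 ≤ (s • a + t • b).1 i
      simp only [H0.add_coord, H0.smul_coord]
      nlinarith
    refine convexHull_min ?_ hc hx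
    rintro _ ⟨j, rfl⟩
    change -1 ≤ (simplexVertex n j).1 i
    rw [simplexVertex_coord]
    have : (0 : ℝ) ≤ n := Nat.cast_nonneg n
    split_ifs <;> linarith
  · intro hx
    have hn : (0 : ℝ) < n + 1 := by positivity
    -- These are the barycentric coordinates of `x`.
    have hw : ∑ i, (x.1 i + 1) / (n + 1) = 1 := by
      rw [← Finset.sum_div, Finset.sum_add_distrib, H0.sum_coord]
      simp [hn.ne']
    have hmem : ∑ i, ((x.1 i + 1) / (n + 1)) • simplexVertex n i ∈ regularSimplex n :=
      (convex_convexHull ℝ _).sum_mem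
        (fun i _ => div_nonneg (by linarith [hx i]) hn.le) hw
        fun i _ => subset_convexHull ℝ _ (Set.mem_range_self i)
    convert hmem using 1
    refine H0.ext_coord fun j => ?_
    rw [coord_sum]
    have h1 : ∀ i, (((x.1 i + 1) / (n + 1)) • simplexVertex n i).1 j =
        (if i = j then x.1 i + 1 else 0) - (x.1 i + 1) / (n + 1) := by
      intro i
      rw [H0.smul_coord, simplexVertex_coord]
      split_ifs
      · field_simp; ring
      · ring
    simp only [h1]
    rw [Finset.sum_sub_distrib, hw]
    simp

theorem mem_dilate_regularSimplex {p q : H0 n} {r : ℝ} (hr : 0 ≤ r) :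
    q ∈ dilate (regularSimplex n) p r ↔ ∀ i, p.1 i - q.1 i ≤ r := by
  constructor
  · rintro ⟨x, hx, rfl⟩ i
    have := mem_regularSimplex.1 hx i
    simp only [H0.add_coord, H0.smul_coord]
    nlinarith
  · intro h
    rcases hr.eq_or_lt with rfl | hr
    · have : p = q := H0.eq_of_le fun i => by linarith [h i]
      exact ⟨0, mem_regularSimplex.2 fun i => by simp, by simp [this]⟩
    · refine ⟨r⁻¹ • (q - p), mem_regularSimplex.2 fun i => ?_, ?_⟩
      · simp only [H0.sub_coord, H0.smul_coord]
        rw [neg_le_iff_add_nonneg, ← mul_inv_cancel₀ hr.ne', mul_comm r, ← mul_add]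
        exact mul_nonneg (inv_nonneg.2 hr.le) (by linarith [h i])
      · simp only
        rw [smul_inv_smul₀ hr.ne']
        abel

/-- Reflection exchanges centre and point; this is why the dual body is the negative. -/
theorem dilate_neg {E : Type*} [NormedAddCommGroup E] [NormedSpace ℝ E] {P : Set E} {p q : E}
    {r : ℝ} : q ∈ dilate (-P) p r ↔ p ∈ dilate P q r := by
  constructor
  · rintro ⟨x, hx, rfl⟩
    exact ⟨-x, hx, by simp⟩
  · rintro ⟨x, hx, rfl⟩
    exact ⟨-x, by simpa using hx, by simp⟩

theorem polyDist_le_iff {p q : H0 n} {t : ℝ} :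
    polyDist (regularSimplex n) p q ≤ t ↔ ∀ i, p.1 i - q.1 i ≤ t := by
  have hleast : IsLeast {r : ℝ | 0 ≤ r ∧ q ∈ dilate (regularSimplex n) p r}
      (Finset.univ.sup' Finset.univ_nonempty fun i => p.1 i - q.1 i) := by
    have h0 : 0 ≤ Finset.univ.sup' Finset.univ_nonempty fun i => p.1 i - q.1 i := by
      obtain ⟨i, hi⟩ := H0.exists_nonneg (p - q)
      exact hi.trans (Finset.le_sup' (fun i => p.1 i - q.1 i) (Finset.mem_univ i))
    refine ⟨⟨h0, (mem_dilate_regularSimplex h0).2 fun i =>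
      Finset.le_sup' (fun i => p.1 i - q.1 i) (Finset.mem_univ i)⟩, ?_⟩
    rintro r ⟨hr, hq⟩
    exact Finset.sup'_le _ _ fun i _ => (mem_dilate_regularSimplex hr).1 hq i
  rw [polyDist, hleast.csInf_eq, Finset.sup'_le_iff]
  simp

theorem polyDist_nonneg {E : Type*} [NormedAddCommGroup E] [NormedSpace ℝ E] (P : Set E) (p q : E) :
    0 ≤ polyDist P p q := Real.sInf_nonneg fun _ h => h.1

/-! ### The distance to the Laplacian lattice. -/

namespace Multigraph

variable (G : Multigraph n)

theorem row_coord (i j : Fin (n + 1)) : (G.row i).1 j = (G.laplacian i j : ℝ) := rfl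

theorem sum_mul_laplacian (f : Fin (n + 1) → ℤ) (j : Fin (n + 1)) :
    ∑ i, f i * G.laplacian i j = G.lap f j := by
  simp only [laplacian, Matrix.sub_apply, Matrix.diagonal_apply, Matrix.of_apply, mul_sub, lap,
    Finset.sum_sub_distrib]
  congr 1
  · simp [Finset.mul_sum, mul_comm]
  · exact Finset.sum_congr rfl fun i _ => by rw [G.symm, mul_comm]

theorem sum_zsmul_row_coord (f : Fin (n + 1) → ℤ) (j : Fin (n + 1)) :
    (∑ i, f i • G.row i).1 j = (G.lap f j : ℝ) := by
  rw [coord_sum, ← sum_mul_laplacian]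
  push_cast
  exact Finset.sum_congr rfl fun i _ => H0.zsmul_coord _ _ _

theorem sum_zsmul_row_mem (f : Fin (n + 1) → ℤ) : ∑ i, f i • G.row i ∈ G.lattice :=
  sum_mem fun i _ => zsmul_mem (AddSubgroup.subset_closure (Set.mem_range_self i)) _

theorem mem_lattice_iff {q : H0 n} :
    q ∈ G.lattice ↔ ∃ f : Fin (n + 1) → ℤ, ∀ i, q.1 i = (G.lap f i : ℝ) := by
  constructor
  · intro hq
    induction hq using AddSubgroup.closure_induction with
    | mem x hx =>
      obtain ⟨i, rfl⟩ := hx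
      refine ⟨Pi.single i 1, fun j => ?_⟩
      rw [row_coord, ← sum_mul_laplacian]
      simp [Pi.single_apply]
    | zero => exact ⟨0, fun i => by simp [lap]⟩
    | add x y _ _ hx hy =>
      obtain ⟨f, hf⟩ := hx
      obtain ⟨g, hg⟩ := hy
      exact ⟨f + g, fun i => by rw [lap_add, H0.add_coord, hf, hg]; push_cast; rfl⟩
    | neg x _ hx =>
      obtain ⟨f, hf⟩ := hx
      exact ⟨-f, fun i => by rw [lap_neg, H0.neg_coord, hf]; push_cast; rfl⟩
  · rintro ⟨f, hf⟩
    have : q = ∑ i, f i • G.row i :=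
      H0.ext_coord fun j => by rw [hf, sum_zsmul_row_coord]
    exact this ▸ G.sum_zsmul_row_mem f

/-- The distance to the Laplacian lattice. -/
noncomputable def height (p : H0 n) : ℝ := distFun (regularSimplex n) (G.lattice : Set (H0 n)) p

/-- Lower bounds on all coordinates give upper bounds because the sum is zero, and lattice points
are integral. -/
theorem finite_lattice_near (p : H0 n) (t : ℝ) :
    {q : H0 n | q ∈ G.lattice ∧ ∀ i, p.1 i - q.1 i ≤ t}.Finite := by
  obtain ⟨N, hN⟩ : ∃ N : ℕ, ∀ i, t - p.1 i ≤ N := by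
    obtain ⟨N, hN⟩ := exists_nat_ge (∑ i, |t - p.1 i|)
    exact ⟨N, fun i => (le_abs_self _).trans
      ((Finset.single_le_sum (f := fun i => |t - p.1 i|) (fun _ _ => abs_nonneg _)
        (Finset.mem_univ i)).trans hN)⟩
  refine Set.Finite.of_finite_image (f := fun q i => ⌊q.1 i⌋) ?_ ?_
  · refine (Set.finite_Icc (fun _ => -(N : ℤ)) fun _ : Fin (n + 1) => (n * N : ℤ)).subset ?_
    rintro _ ⟨q, ⟨-, hq⟩, rfl⟩
    have hlow : ∀ i, -(N : ℝ) ≤ q.1 i := fun i => by linarith [hq i, hN i]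
    refine ⟨fun i => Int.le_floor.2 (by push_cast; exact hlow i), fun i => ?_⟩
    refine Int.floor_le_iff.2 ?_
    have h1 := H0.sum_coord q
    rw [← Finset.add_sum_erase _ _ (Finset.mem_univ i)] at h1
    have h2 := Finset.sum_le_sum (s := Finset.univ.erase i) fun j _ => hlow j
    rw [Finset.sum_const, Finset.card_erase_of_mem (Finset.mem_univ i), Finset.card_univ,
      Fintype.card_fin, Nat.add_sub_cancel, nsmul_eq_mul] at h2
    push_cast
    linarith
  · rintro q ⟨hq, -⟩ q' ⟨hq', -⟩ h
    obtain ⟨f, hf⟩ := G.mem_lattice_iff.1 hq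
    obtain ⟨f', hf'⟩ := G.mem_lattice_iff.1 hq'
    refine H0.ext_coord fun i => ?_
    have := congrFun h i
    simp only [hf, hf', Int.floor_intCast] at this ⊢
    rw [this]

/-- The infimum is attained, since only finitely many lattice points are at least as near as 0. -/
theorem height_le_iff {p : H0 n} {t : ℝ} :
    G.height p ≤ t ↔ ∃ q ∈ G.lattice, ∀ i, p.1 i - q.1 i ≤ t := by
  have hbdd : BddBelow (polyDist (regularSimplex n) p '' (G.lattice : Set (H0 n))) :=
    ⟨0, by rintro _ ⟨q, -, rfl⟩; exact polyDist_nonneg _ _ _⟩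
  constructor
  · intro h
    obtain ⟨q₀, ⟨hq₀, -⟩, hmin⟩ := Set.exists_min_image _ (polyDist (regularSimplex n) p)
      (G.finite_lattice_near p (polyDist (regularSimplex n) p 0))
      ⟨0, G.lattice.zero_mem, polyDist_le_iff.1 le_rfl⟩
    refine ⟨q₀, hq₀, polyDist_le_iff.1 (le_trans ?_ h)⟩
    refine le_csInf ⟨_, ⟨0, G.lattice.zero_mem, rfl⟩⟩ ?_
    rintro _ ⟨q, hq, rfl⟩
    rcases le_total (polyDist (regularSimplex n) p q) (polyDist (regularSimplex n) p 0) with h' | h'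
    · exact hmin q ⟨hq, polyDist_le_iff.1 h'⟩
    · exact (hmin 0 ⟨G.lattice.zero_mem, polyDist_le_iff.1 le_rfl⟩).trans h'
  · rintro ⟨q, hq, h⟩
    exact (csInf_le hbdd ⟨q, hq, rfl⟩).trans (polyDist_le_iff.2 h)

theorem le_height_iff {p : H0 n} {t : ℝ} :
    t ≤ G.height p ↔ ∀ q ∈ G.lattice, ∃ i, t ≤ p.1 i - q.1 i := by
  constructor
  · intro h q hq
    by_contra! hcon
    have h1 : G.height p ≤ polyDist (regularSimplex n) p q :=
      G.height_le_iff.2 ⟨q, hq, polyDist_le_iff.1 le_rfl⟩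
    obtain ⟨i, -, hi⟩ := Finset.exists_max_image Finset.univ (fun i => p.1 i - q.1 i)
      Finset.univ_nonempty
    have h2 : polyDist (regularSimplex n) p q ≤ p.1 i - q.1 i :=
      polyDist_le_iff.2 fun j => hi j (Finset.mem_univ j)
    linarith [hcon i]
  · intro h
    by_contra! hcon
    obtain ⟨q, hq, h'⟩ := G.height_le_iff.1 le_rfl
    obtain ⟨i, hi⟩ := h q hq
    linarith [h' i]

theorem height_nonneg (p : H0 n) : 0 ≤ G.height p :=
  G.le_height_iff.2 fun q _ => H0.exists_nonneg (p - q)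

theorem height_le_add {p p' : H0 n} {t : ℝ} (h : ∀ i, p.1 i ≤ p'.1 i + t) :
    G.height p ≤ G.height p' + t := by
  obtain ⟨q, hq, h'⟩ := G.height_le_iff.1 (le_refl (G.height p'))
  exact G.height_le_iff.2 ⟨q, hq, fun i => by linarith [h i, h' i]⟩

theorem continuous_height : Continuous G.height := by
  refine LipschitzWith.continuous (K := 1) (LipschitzWith.of_le_add fun p p' => ?_)
  refine G.height_le_add fun i => ?_
  have h1 := H0.abs_coord_le_norm (p - p') i
  have h2 := le_abs_self ((p - p').1 i)
  rw [H0.sub_coord] at h1 h2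
  rw [dist_eq_norm]
  linarith

/-! ### Critical points and duality for the regular simplex. -/

/-- The common height of all critical points. -/
noncomputable def maxHeight : ℝ := (∑ v, ∑ w, (G.b v w : ℝ)) / (2 * (n + 1))

theorem exists_height_eq_maxHeight (hG : G.Connected) (p : H0 n) :
    ∃ c : H0 n, G.height c = G.maxHeight ∧ G.height p ≤ G.maxHeight ∧
      ∀ i, c.1 i ≤ p.1 i + (G.maxHeight - G.height p) := by
  have hn : (0 : ℝ) < n + 1 := by positivity
  have key : ∀ p : H0 n, ∃ y : Fin (n + 1) → ℤ, (∀ i, (y i : ℝ) ≤ p.1 i - G.height p) ∧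
      (∀ f, ∃ i, G.lap f i ≤ y i) ∧ ∑ i, (y i : ℝ) = -((n + 1) * G.maxHeight) := by
    intro p
    -- Rounding down is harmless because lattice points are integral.
    obtain ⟨y, hy, hyN, hsum⟩ := G.exists_extremal_le hG (fun i => ⌊p.1 i - G.height p⌋) fun f => by
      obtain ⟨i, hi⟩ := G.le_height_iff.1 (le_refl (G.height p)) _ (G.sum_zsmul_row_mem f)
      rw [sum_zsmul_row_coord] at hi
      exact ⟨i, Int.le_floor.2 (by linarith)⟩
    refine ⟨y, fun i => Int.le_floor.1 (hy i), hyN, ?_⟩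
    have h2 : (2 : ℝ) * ∑ i, (y i : ℝ) = -∑ v, ∑ w, (G.b v w : ℝ) := by exact_mod_cast hsum
    rw [maxHeight]
    field_simp
    linarith
  have hle : ∀ p : H0 n, G.height p ≤ G.maxHeight := fun p => by
    obtain ⟨y, hy, -, hsum⟩ := key p
    have := Finset.sum_le_sum (s := Finset.univ) fun i _ => hy i
    rw [hsum, Finset.sum_sub_distrib, H0.sum_coord] at this
    simp at this
    nlinarith
  obtain ⟨y, hy, hyN, hsum⟩ := key p
  have hc : ∀ i, (H0.proj fun i => (y i : ℝ)).1 i = y i + G.maxHeight := fun i => by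
    rw [H0.proj_coord, hsum]
    field_simp
    ring
  refine ⟨H0.proj fun i => (y i : ℝ), le_antisymm (hle _) ?_, hle p, fun i => ?_⟩
  · refine G.le_height_iff.2 fun q hq => ?_
    obtain ⟨f, hf⟩ := G.mem_lattice_iff.1 hq
    obtain ⟨i, hi⟩ := hyN f
    refine ⟨i, ?_⟩
    rw [hc, hf]
    have : (G.lap f i : ℝ) ≤ y i := by exact_mod_cast hi
    linarith
  · rw [hc]
    linarith [hy i]

theorem height_le_maxHeight (hG : G.Connected) (p : H0 n) : G.height p ≤ G.maxHeight :=
  (G.exists_height_eq_maxHeight hG p).choose_spec.2.1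

/-- If `c` lies below the maximal height, the point `c'` above it leaves slack in some coordinate
`i`. Lowering that coordinate by a small ε and projecting back to `H0` raises the height by at least
ε/(n+1), so `c` is no local maximum. -/
theorem mem_critSet_iff (hG : G.Connected) {c : H0 n} :
    c ∈ G.critSet ↔ G.height c = G.maxHeight := by
  have hn : (0 : ℝ) < n + 1 := by positivity
  constructor
  · intro hc
    have hc : IsLocalMax G.height c := hc
    obtain ⟨c', hc', -, hle⟩ := G.exists_height_eq_maxHeight hG c
    by_contra hne
    have hlt := lt_of_le_of_ne (G.height_le_maxHeight hG c) hne
    obtain ⟨i, hi⟩ : ∃ i, c'.1 i < c.1 i + (G.maxHeight - G.height c) := by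
      obtain ⟨i, hi⟩ := H0.exists_nonneg (c - c')
      rw [H0.sub_coord] at hi
      exact ⟨i, by linarith⟩
    classical
    have ht : Filter.Tendsto (fun ε : ℝ => c - ε • H0.proj (Pi.single i 1))
        (nhdsWithin 0 (Set.Ioi 0)) (nhds c) := by
      have h1 : Continuous fun ε : ℝ => c - ε • (H0.proj (Pi.single i 1) : H0 n) := by fun_prop
      have h2 := h1.tendsto 0
      rw [zero_smul, sub_zero] at h2
      exact h2.mono_left nhdsWithin_le_nhds
    have hev := ht.eventually hc
    have hev2 : ∀ᶠ ε : ℝ in nhdsWithin 0 (Set.Ioi 0),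
        ε < c.1 i + (G.maxHeight - G.height c) - c'.1 i :=
      nhdsWithin_le_nhds (Iio_mem_nhds (by linarith))
    obtain ⟨ε, ⟨h1, h2⟩, hε⟩ := ((hev.and hev2).and self_mem_nhdsWithin).exists
    have hε : 0 < ε := hε
    have h3 : G.height c' ≤ G.height (c - ε • H0.proj (Pi.single i 1)) +
        (G.maxHeight - G.height c - ε / (n + 1)) := by
      refine G.height_le_add fun j => ?_
      rw [H0.sub_coord, H0.smul_coord, H0.proj_coord]
      have hs : ∑ j, (Pi.single i 1 : Fin (n + 1) → ℝ) j = 1 := by simp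
      rw [hs, mul_sub, mul_one_div]
      by_cases hj : j = i
      · subst hj
        rw [Pi.single_eq_same]
        linarith
      · rw [Pi.single_eq_of_ne hj]
        linarith [hle j]
    have h4 : 0 < ε / (n + 1) := by positivity
    linarith
  · intro h
    refine Filter.Eventually.of_forall fun p => ?_
    change G.height p ≤ G.height c
    rw [h]
    exact G.height_le_maxHeight hG p

theorem mem_arrangement_critSet (hG : G.Connected) {R : ℝ} (hR : 0 ≤ R) {p : H0 n} :
    p ∈ arrangement G.critSet (regularSimplex n) R ↔ G.maxHeight - R ≤ G.height p := by
  simp only [arrangement, Set.mem_iUnion, exists_prop, mem_dilate_regularSimplex hR,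
    mem_critSet_iff G hG]
  constructor
  · rintro ⟨c, hc, h⟩
    have := G.height_le_add (p := c) (p' := p) (t := R) fun i => by linarith [h i]
    linarith
  · intro h
    obtain ⟨c, hc, -, hle⟩ := G.exists_height_eq_maxHeight hG p
    exact ⟨c, hc, fun i => by linarith [hle i]⟩

theorem mem_arrangement_lattice {R : ℝ} (hR : 0 ≤ R) {p : H0 n} :
    p ∈ arrangement (G.lattice : Set (H0 n)) (-regularSimplex n) R ↔ G.height p ≤ R := by
  simp only [arrangement, Set.mem_iUnion, exists_prop, dilate_neg, mem_dilate_regularSimplex hR,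
    height_le_iff, SetLike.mem_coe]

/-- The height has no local minima of positive value. -/
theorem interior_le_height {s : ℝ} (hs : 0 < s) :
    interior {p : H0 n | s ≤ G.height p} = {p | s < G.height p} := by
  refine Set.Subset.antisymm (fun p hp => ?_)
    (interior_maximal (fun p (hp : s < G.height p) => hp.le)
      (isOpen_lt continuous_const G.continuous_height))
  by_contra hlt
  have hsp : p ∈ {p : H0 n | s ≤ G.height p} := interior_subset hp
  have hps : G.height p = s := le_antisymm (not_lt.1 hlt) hsp
  obtain ⟨q, hq, hle⟩ := G.height_le_iff.1 hps.le
  -- Moving towards a nearest lattice point `q` multiplies the height bound by 1 - ε.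
  have ht : Filter.Tendsto (fun ε : ℝ => p - ε • (p - q)) (nhdsWithin 0 (Set.Ioi 0)) (nhds p) := by
    have h1 : Continuous fun ε : ℝ => p - ε • (p - q) := by fun_prop
    have h2 := h1.tendsto 0
    rw [zero_smul, sub_zero] at h2
    exact h2.mono_left nhdsWithin_le_nhds
  have hev := ht.eventually (mem_interior_iff_mem_nhds.1 hp)
  have hev2 : ∀ᶠ ε : ℝ in nhdsWithin 0 (Set.Ioi 0), ε < 1 :=
    nhdsWithin_le_nhds (Iio_mem_nhds one_pos)
  obtain ⟨ε, ⟨h1, h2⟩, hε⟩ := ((hev.and hev2).and self_mem_nhdsWithin).exists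
  have hε : 0 < ε := hε
  have h1 : s ≤ G.height (p - ε • (p - q)) := h1
  have h3 : G.height (p - ε • (p - q)) ≤ (1 - ε) * s := by
    refine G.height_le_iff.2 ⟨q, hq, fun i => ?_⟩
    simp only [H0.sub_coord, H0.smul_coord]
    nlinarith [hle i]
  nlinarith

/-- The duality theorem for the regular simplex. -/
theorem regularSimplex_duality (hG : G.Connected) {R : ℝ} (hR : 0 < R)
    (hcov : arrangement G.critSet (regularSimplex n) R ≠ Set.univ) :
    ∃ R' : ℝ, 0 < R' ∧ ∀ p : H0 n,
      p ∈ interior (arrangement G.critSet (regularSimplex n) R) ↔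
        p ∉ arrangement (G.lattice : Set (H0 n)) (-regularSimplex n) R' := by
  have hR' : 0 < G.maxHeight - R := by
    by_contra! h
    exact hcov (Set.eq_univ_of_forall fun p => (G.mem_arrangement_critSet hG hR.le).2
      (h.trans (G.height_nonneg p)))
  refine ⟨_, hR', fun p => ?_⟩
  have h1 : arrangement G.critSet (regularSimplex n) R =
      {p | G.maxHeight - R ≤ G.height p} :=
    Set.ext fun p => G.mem_arrangement_critSet hG hR.le
  rw [h1, interior_le_height G hR', mem_arrangement_lattice G hR'.le, not_le]
  rfl

theorem height_add_of_mem {v : H0 n} (hv : v ∈ G.lattice) (p : H0 n) :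
    G.height (p + v) = G.height p := by
  have key : ∀ (p v : H0 n), v ∈ G.lattice → G.height (p + v) ≤ G.height p := fun p v hv => by
    obtain ⟨q, hq, h⟩ := G.height_le_iff.1 (le_refl (G.height p))
    refine G.height_le_iff.2 ⟨q + v, add_mem hq hv, fun i => ?_⟩
    simp only [H0.add_coord]
    linarith [h i]
  refine le_antisymm (key p v hv) ?_
  simpa using key (p + v) (-v) (neg_mem hv)

/-- The Laplacian lattice is the translation group of its critical set. -/
theorem mem_lattice_iff_critSet (hG : G.Connected) {v : H0 n} :
    v ∈ G.lattice ↔ ∀ c, c ∈ G.critSet ↔ c + v ∈ G.critSet := by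
  constructor
  · intro hv c
    rw [mem_critSet_iff G hG, mem_critSet_iff G hG, height_add_of_mem G hv]
  · intro h
    by_contra hv
    have hpos : 0 < G.height v := by
      by_contra! h0
      obtain ⟨q, hq, hle⟩ := G.height_le_iff.1 h0
      exact hv ((H0.eq_of_le fun i => by linarith [hle i] : v = q) ▸ hq)
    have hmax := G.height_le_maxHeight hG v
    -- Invariance makes `c - v` critical, yet its distance to the lattice point 0 is at most the
    -- maximum minus `G.height v`, which is too small.
    obtain ⟨c, hc, -, hle⟩ := G.exists_height_eq_maxHeight hG v
    have hc0 : G.height (c - v) = G.maxHeight := by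
      rw [← mem_critSet_iff G hG] at hc ⊢
      exact (h _).2 (by simpa using hc)
    have h0 : G.height 0 ≤ 0 := G.height_le_iff.2 ⟨0, zero_mem _, fun i => by simp⟩
    have := G.height_le_add (p := c - v) (p' := 0) (t := G.maxHeight - G.height v) fun i => by
      simp only [H0.sub_coord, H0.zero_coord]
      linarith [hle i]
    linarith

end Multigraph

end GraphDuality

/-! ### Transport along a critical automorphism. -/

namespace GraphDuality

theorem dilate_image {E : Type*} [NormedAddCommGroup E] [NormedSpace ℝ E] (M : E ≃ₗ[ℝ] E)
    (P : Set E) (p : E) (r : ℝ) : dilate (M '' P) (M p) r = M '' dilate P p r := by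
  simp only [dilate, Set.image_image, map_add, map_smul]

theorem arrangement_image {E : Type*} [NormedAddCommGroup E] [NormedSpace ℝ E] (M : E ≃ₗ[ℝ] E)
    {D : Set E} (hD : M '' D = D) (P : Set E) (r : ℝ) :
    arrangement D (M '' P) r = M '' arrangement D P r := by
  conv_lhs => rw [← hD]
  simp only [arrangement, Set.biUnion_image, dilate_image, Set.image_iUnion₂]

variable {n : ℕ}

theorem zero_mem_interior_regularSimplex : (0 : H0 n) ∈ interior (regularSimplex n) := by
  have hopen : IsOpen {x : H0 n | ∀ i, -1 < x.1 i} := by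
    simp only [Set.ofPred_forall]
    exact isOpen_iInter_of_finite fun i => isOpen_lt continuous_const (H0.continuous_coord i)
  refine interior_maximal (fun x hx => ?_) hopen (fun i => by simp)
  exact mem_regularSimplex.2 fun i => (hx i).le

theorem image_interior (M : H0 n ≃ₗ[ℝ] H0 n) (A : Set (H0 n)) :
    M '' interior A = interior (M '' A) :=
  M.toContinuousLinearEquiv.toHomeomorph.image_interior A

theorem isStarBody_neg_image_regularSimplex (M : H0 n ≃ₗ[ℝ] H0 n) :
    IsStarBody (-(M '' regularSimplex n)) := by
  have h0 : (0 : H0 n) ∈ interior (M '' regularSimplex n) := by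
    rw [← image_interior]
    exact ⟨0, zero_mem_interior_regularSimplex, map_zero M⟩
  have hcomp : IsCompact (regularSimplex n) :=
    (Set.finite_range (simplexVertex n)).isCompact_convexHull ℝ
  have hconv : Convex ℝ (-(M '' regularSimplex n)) :=
    ((convex_convexHull ℝ (Set.range (simplexVertex n))).linear_image M.toLinearMap).neg
  have hint : (0 : H0 n) ∈ interior (-(M '' regularSimplex n)) := by
    have h := (Homeomorph.neg (H0 n)).image_interior (M '' regularSimplex n)
    rw [Homeomorph.coe_neg, Set.image_neg_eq_neg, Set.image_neg_eq_neg] at h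
    rw [← h]
    simpa using h0
  exact ⟨(hcomp.image M.toContinuousLinearEquiv.continuous).neg, hint,
    hconv.starConvex (interior_subset hint)⟩

/-- A linear bijection preserving a set also preserves the group of translations of that set. -/
theorem Multigraph.image_lattice {G : Multigraph n} (hG : G.Connected) {M : H0 n ≃ₗ[ℝ] H0 n}
    (hM : M ∈ G.criticalAutomorphismGroup) :
    M '' (G.lattice : Set (H0 n)) = G.lattice := by
  have hcrit : ∀ c, M c ∈ G.critSet ↔ c ∈ G.critSet := fun c => by
    have hM : Set.BijOn M G.critSet G.critSet := hM
    rw [← hM.image_eq, M.injective.mem_set_image, hM.image_eq]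
  have hlat : ∀ v, M v ∈ G.lattice ↔ v ∈ G.lattice := fun v => by
    rw [G.mem_lattice_iff_critSet hG, G.mem_lattice_iff_critSet hG, ← M.toEquiv.forall_congr_right]
    refine forall_congr' fun c => ?_
    change (M c ∈ G.critSet ↔ M c + M v ∈ G.critSet) ↔ (c ∈ G.critSet ↔ c + v ∈ G.critSet)
    rw [← map_add, hcrit, hcrit]
  ext v
  constructor
  · rintro ⟨w, hw, rfl⟩
    exact (hlat w).2 hw
  · intro hv
    exact ⟨M.symm v, (hlat _).1 (by simpa using hv), by simp⟩

/-- Duality with respect to the image of the regular simplex under a critical automorphism. -/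
theorem Multigraph.isDualBody_image_regularSimplex {G : Multigraph n} (hG : G.Connected)
    {M : H0 n ≃ₗ[ℝ] H0 n} (hM : M ∈ G.criticalAutomorphismGroup) :
    G.IsDualBody (M '' regularSimplex n) (-(M '' regularSimplex n)) := by
  refine ⟨isStarBody_neg_image_regularSimplex M, fun R hR hcov => ?_⟩
  have hcrit : M '' G.critSet = G.critSet := Set.BijOn.image_eq hM
  have hneg : -(M '' regularSimplex n) = M '' (-regularSimplex n) := by
    simp only [← Set.image_neg_eq_neg, Set.image_image, map_neg]
  rw [arrangement_image M hcrit] at hcov ⊢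
  obtain ⟨R', hR', h⟩ := G.regularSimplex_duality hG hR fun hu => hcov (by
    rw [hu, Set.image_univ, M.surjective.range_eq])
  refine ⟨R', hR', M.surjective.forall.2 fun p => ?_⟩
  rw [hneg, arrangement_image M (image_lattice hG hM), ← image_interior,
    M.injective.mem_set_image, M.injective.mem_set_image, h]

end GraphDuality

theorem mainTheorem6 {n : ℕ} (G : GraphDuality.Multigraph n) (hG : G.Connected)
    (S : Affine.Simplex ℝ (GraphDuality.H0 n) n) (hS : S.centroid = 0)
    (hM : ∃ M ∈ G.criticalAutomorphismGroup,
      M '' GraphDuality.regularSimplex n = convexHull ℝ (Set.range S.points)) :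
    G.HasDuality (convexHull ℝ (Set.range S.points)) ∧
      G.IsDualBody (convexHull ℝ (Set.range S.points))
        (-convexHull ℝ (Set.range S.points)) := by
  obtain ⟨M, hMG, hMS⟩ := hM
  have h := GraphDuality.Multigraph.isDualBody_image_regularSimplex hG hMG
  rw [hMS] at h
  exact ⟨⟨_, h⟩, h⟩
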